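/- All matrices are real and $n\times n$, with $n\ge 2$. A matrix is totally nonnegative (TN) [totally positive (TP)] if all its minors are nonnegative [positive]; it is oscillatory if it is TN and some power $A^p$, $p\ge 1$, is TP. For $i\in\{2,\dots,n\}$ and $q\in\mathbb R$ let $L_i(q):=I+qE_{i,i-1}$, where $E_{i,i-1}$ has a one in position $(i,i-1)$ and zeros elsewhere, and let $U_i(q):=L_i(q)^T$. A block $W_i$ is a product $L_n(w_n)L_{n-1}(w_{n-1})\cdots L_i(w_i)$ and a block $Q_i$ is a product $U_i(v_i)U_{i+1}(v_{i+1})\cdots U_n(v_n)$, with multipliers $w_t,v_t\ge 0$ that may differ from block to block. The successive elementary bidiagonal (SEB) factorization of an invertible TN matrix $A$ is $A=LDU$ with $L=W_2W_3\cdots W_n$, $U=Q_nQ_{n-1}\cdots Q_2$, and $D$ diagonal with positive diagonal entries. For $s\in\{2,\dots,n\}$, let $Z_1(s)$ be the class of matrices $W_2W_3\cdots W_s$ with all multipliers positive, and put $\mu_1(s):=\left\lceil\frac{n-1}{s-1}\right\rceil$. For $s\in\{3,\dots,n\}$, let $Z_2(s)$ be the class of matrices $L_2(q_2)\cdots L_{s-2}(q_{s-2})\,P\,W_sW_{s+1}\cdots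 W_n$, where all $q_t$ and all multipliers of $W_s,\dots,W_n$ are positive, and $P$ is a block $W_{s-1}$ with nonnegative multipliers in which the multiplier of $L_{s-1}$ is positive and at least one of the other multipliers is zero; let $Z_2(2)$ be the class of matrices $W_2W_3\cdots W_n$ with all multipliers positive. Put $\mu_2(s):=s-1$ for $s\in\{2,\dots,n\}$. Let $A_1,\dots,A_m$ be oscillatory matrices with SEB factorizations $A_x=L(x)D(x)U(x)$. Suppose that there exist $i,j\in\{1,2\}$ and $s_i,s_j\in\{2,\dots,n\}$ such that $L(x)\in Z_i(s_i)$ and $U(x)^T\in Z_j(s_j)$ for all $x\in\{1,\dots,m\}$; the multiplier values and the diagonal matrices may differ for different $x$. Then a product of any $k$ matrices from this set (in any order, repetitions allowed) is TP if and only if $$k\ge\max\{\mu_i(s_i),\mu_j(s_j)\}.$$ -/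

import Mathlib

/-- `A` is totally nonnegative (TN): all minors of `A` are nonnegative. -/
def IsTN {n : ℕ} (A : Matrix (Fin n) (Fin n) ℝ) : Prop :=
  ∀ (p : ℕ) (r c : Fin p → Fin n), StrictMono r → StrictMono c → 0 ≤ (A.submatrix r c).det

/-- `A` is totally positive (TP): all minors of `A` are positive. -/
def IsTP {n : ℕ} (A : Matrix (Fin n) (Fin n) ℝ) : Prop :=
  ∀ (p : ℕ) (r c : Fin p → Fin n), StrictMono r → StrictMono c → 0 < (A.submatrix r c).det

/-- `A` is oscillatory: it is TN and some positive power of it is TP. -/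
def IsOscillatory {n : ℕ} (A : Matrix (Fin n) (Fin n) ℝ) : Prop :=
  IsTN A ∧ ∃ k : ℕ, 0 < k ∧ IsTP (A ^ k)

/-- The elementary bidiagonal matrix `L_i(q) = I + q E_{i,i-1}`, for `2 ≤ i ≤ n`. The index `i`
counts rows from `1`, whereas the elements of `Fin n` start at `0`. -/
def elemL (n i : ℕ) (q : ℝ) : Matrix (Fin n) (Fin n) ℝ :=
  1 + Matrix.of fun (a b : Fin n) => if (a : ℕ) + 1 = i ∧ (b : ℕ) + 2 = i then q else 0

/-- The elementary bidiagonal matrix `U_i(q)`, the transpose of `L_i(q)`. -/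
def elemU (n i : ℕ) (q : ℝ) : Matrix (Fin n) (Fin n) ℝ :=
  (elemL n i q).transpose

/-- `W_i = L_n(w n) L_{n-1}(w (n-1)) ⋯ L_i(w i)`; here `w j` is the multiplier of `L_j`. -/
def blockW (n i : ℕ) (w : ℕ → ℝ) : Matrix (Fin n) (Fin n) ℝ :=
  ((List.range' i (n + 1 - i)).reverse.map fun j => elemL n j (w j)).prod

/-- `Q_i = U_i(w i) U_{i+1}(w (i+1)) ⋯ U_n(w n)`; here `w j` is the multiplier of `U_j`. -/
def blockQ (n i : ℕ) (w : ℕ → ℝ) : Matrix (Fin n) (Fin n) ℝ :=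
  ((List.range' i (n + 1 - i)).map fun j => elemU n j (w j)).prod

/-- The product `W_2 W_3 ⋯ W_n` of all the `L` matrices in the SEB factorization;
`l i j` (for `2 ≤ i ≤ j ≤ n`) is the multiplier of `L_j` in the block `W_i`. -/
def lowerFactor (n : ℕ) (l : ℕ → ℕ → ℝ) : Matrix (Fin n) (Fin n) ℝ :=
  ((List.range' 2 (n - 1)).map fun i => blockW n i (l i)).prod

/-- The product `Q_n Q_{n-1} ⋯ Q_2` of all the `U` matrices in the SEB factorization;
`u i j` (for `2 ≤ i ≤ j ≤ n`) is the multiplier of `U_j` in the block `Q_i`. -/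
def upperFactor (n : ℕ) (u : ℕ → ℕ → ℝ) : Matrix (Fin n) (Fin n) ℝ :=
  ((List.range' 2 (n - 1)).reverse.map fun i => blockQ n i (u i)).prod

/-- `A = W_2 ⋯ W_n D Q_n ⋯ Q_2`, with nonnegative multipliers `l`, `u` and with positive diagonal
entries `d` of `D`, is the successive elementary bidiagonal (SEB) factorization of `A`. -/
structure IsSEBFactorization {n : ℕ} (A : Matrix (Fin n) (Fin n) ℝ)
    (l : ℕ → ℕ → ℝ) (d : Fin n → ℝ) (u : ℕ → ℕ → ℝ) : Prop where
  lower_nonneg : ∀ i j : ℕ, 2 ≤ i → i ≤ j → j ≤ n → 0 ≤ l i j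
  upper_nonneg : ∀ i j : ℕ, 2 ≤ i → i ≤ j → j ≤ n → 0 ≤ u i j
  diag_pos : ∀ a : Fin n, 0 < d a
  eq_mul : A = lowerFactor n l * Matrix.diagonal d * upperFactor n u

/-- The class `Z_1(s)` of the matrices `W_2 ⋯ W_s` with all multipliers positive. -/
def classZ1 (n s : ℕ) : Set (Matrix (Fin n) (Fin n) ℝ) :=
  {M | ∃ l : ℕ → ℕ → ℝ,
    (∀ i j : ℕ, 2 ≤ i → i ≤ s → i ≤ j → j ≤ n → 0 < l i j) ∧
    M = ((List.range' 2 (s - 1)).map fun i => blockW n i (l i)).prod}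

/-- The set `Ψ_i` of the matrices `L_n(w n) ⋯ L_{i+1}(w (i+1)) L_i(w i)` with nonnegative
multipliers in which the multiplier of `L_i` is positive and at least one of the other
multipliers is zero. -/
def classPsi (n i : ℕ) : Set (Matrix (Fin n) (Fin n) ℝ) :=
  {M | ∃ w : ℕ → ℝ, 0 < w i ∧ (∀ j : ℕ, i < j → j ≤ n → 0 ≤ w j) ∧
    (∃ j : ℕ, i < j ∧ j ≤ n ∧ w j = 0) ∧ M = blockW n i w}

/-- The class `Z_2(s)` of the matrices `L_2 ⋯ L_{s-2} P W_s ⋯ W_n` with `P ∈ Ψ_{s-1}` and all the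
multipliers in `L_2, …, L_{s-2}` and in `W_s, …, W_n` positive. For `s = 3` there are no factors
before `P`, and for `s = 2` there is no factor `P` either: the matrices are `W_2 ⋯ W_n`. -/
def classZ2 (n s : ℕ) : Set (Matrix (Fin n) (Fin n) ℝ) :=
  {M | ∃ (q : ℕ → ℝ) (P : Matrix (Fin n) (Fin n) ℝ) (l : ℕ → ℕ → ℝ),
    (∀ i : ℕ, 2 ≤ i → i + 2 ≤ s → 0 < q i) ∧
    (if s = 2 then P = 1 else P ∈ classPsi n (s - 1)) ∧
    (∀ i j : ℕ, s ≤ i → i ≤ j → j ≤ n → 0 < l i j) ∧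
    M = ((List.range' 2 (s - 3)).map fun i => elemL n i (q i)).prod * P *
      ((List.range' s (n + 1 - s)).map fun i => blockW n i (l i)).prod}

/-- The index `i ∈ {1, 2}` of the families `Z_i(s)` and of the functions `μ_i(s)`. -/
inductive ZIndex : Type
  | one
  | two

/-- The class `Z_i(s)` of `n × n` matrices, for `i ∈ {1, 2}` and `s ∈ {2, …, n}`. -/
def classZ (n : ℕ) : ZIndex → ℕ → Set (Matrix (Fin n) (Fin n) ℝ)
  | .one, s => classZ1 n s
  | .two, s => classZ2 n s

/-- `μ_1(s) = ⌈(n - 1) / (s - 1)⌉` and `μ_2(s) = s - 1`, for `s ∈ {2, …, n}`. -/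
noncomputable def mu (n : ℕ) : ZIndex → ℕ → ℕ
  | .one, s => ⌈((n : ℝ) - 1) / ((s : ℝ) - 1)⌉₊
  | .two, s => s - 1

/-! Sufficiency is a statement about words of indices. Left multiplication by L_j(q), q ≥ 0, adds to
a minor whose rows contain j the q-fold of the minor with row j replaced by j-1, and fixes the other
minors. So minors of TN matrices never decrease, and a minor is positive once its row set, seen as
particles hopping from j to a vacant j-1 along the letters with positive multipliers, can reach a
row set with positive minor (`Covers.det_submatrix_mul_pos`).

Upper and lower elementary matrices can be interchanged at the cost of a positive diagonal matrix,
with the signs of the multipliers kept (`elemU_mul_elemL`). A product of k factors is therefore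
again L D Uᵀ, where L and U carry the k-fold repeated words (`HasFactors.list_prod`), and it is TP
if every set of p particles can travel to {1, …, p} (`isTP_of_covers`). For Z_1(s), each block
brings one more particle home, s-1 per factor, and at most n-1 have to move (`path_wordZ1`). For
Z_2(s), the blocks W_s ⋯ W_n of the first factor bring all particles within s-2 of their goals, and
each later factor contains the word 2, …, n, which lowers every displaced particle by one
(`path_wordZ2`).

Necessity comes from supports, which upper triangular factors do not enlarge in the relevant
direction. For Z_2(s), the last row of the product starts no earlier than column s-1 after one
factor, because of the zero multiplier in P, and at most one column earlier with each further
factor; so the (n,1) entry vanishes for fewer than s-1 factors. For Z_1(s), the first column of the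
inverse grows by at most s-1 places per factor, and its last entry is, up to a nonzero factor, the
minor with rows 2, …, n and columns 1, …, n-1. Transposition exchanges the roles of L and U. -/

open Matrix in
/-- A nontrivial elementary bidiagonal matrix is a transvection. -/
theorem elemL_eq_transvection {n b : ℕ} (hb : b + 1 < n) (q : ℝ) :
    elemL n (b + 2) q = transvection ⟨b + 1, hb⟩ ⟨b, by omega⟩ q := by
  ext x y
  simp only [elemL, transvection, Matrix.add_apply, Matrix.of_apply, Matrix.single_apply]
  congr 1
  refine if_congr ?_ rfl rfl
  simp only [Fin.ext_iff]
  omega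

theorem elemL_eq_one {n j : ℕ} (hj : j < 2 ∨ n < j) (q : ℝ) : elemL n j q = 1 := by
  ext x y
  have hx := x.isLt
  simp only [elemL, Matrix.add_apply, Matrix.of_apply, add_eq_left]
  rw [if_neg]
  omega

theorem elemL_zero (n j : ℕ) : elemL n j 0 = 1 := by
  ext x y
  simp [elemL]

/-- Either `elemL n j q = 1` for all `q`, or `j = b + 2` with `b + 1 < n`. -/
theorem elemL_index_cases (n j : ℕ) :
    (j < 2 ∨ n < j) ∨ ∃ b, b + 1 < n ∧ j = b + 2 := by
  by_cases h : j < 2 ∨ n < j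
  · exact Or.inl h
  · exact Or.inr ⟨j - 2, by omega, by omega⟩

theorem elemL_mul_elemL_neg (n j : ℕ) (q : ℝ) : elemL n j q * elemL n j (-q) = 1 := by
  rcases elemL_index_cases n j with h | ⟨b, hb, rfl⟩
  · simp [elemL_eq_one h]
  · rw [elemL_eq_transvection hb, elemL_eq_transvection hb,
      Matrix.transvection_mul_transvection_same _ _ (by simp [Fin.ext_iff])]
    simp

theorem det_elemL (n j : ℕ) (q : ℝ) : (elemL n j q).det = 1 := by
  rcases elemL_index_cases n j with h | ⟨b, hb, rfl⟩
  · simp [elemL_eq_one h]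
  · rw [elemL_eq_transvection hb, Matrix.det_transvection_of_ne _ _ (by simp [Fin.ext_iff])]

theorem elemL_apply_of_lt {n : ℕ} (j : ℕ) (q : ℝ) {x y : Fin n} (h : x < y) :
    elemL n j q x y = 0 := by
  have h' : (x : ℕ) < y := h
  simp only [elemL, Matrix.add_apply, Matrix.of_apply, Matrix.one_apply_ne h.ne, zero_add]
  rw [if_neg]
  omega

/-! ### Minors under multiplication by elementary bidiagonal matrices -/

section TotalNonnegativity

theorem IsTN.transpose {n : ℕ} {M : Matrix (Fin n) (Fin n) ℝ} (h : IsTN M) :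
    IsTN M.transpose := by
  intro p r c hr hc
  rw [← Matrix.transpose_submatrix, Matrix.det_transpose]
  exact h p c r hc hr

theorem IsTP.transpose {n : ℕ} {M : Matrix (Fin n) (Fin n) ℝ} (h : IsTP M) :
    IsTP M.transpose := by
  intro p r c hr hc
  rw [← Matrix.transpose_submatrix, Matrix.det_transpose]
  exact h p c r hc hr

theorem isTN_one (n : ℕ) : IsTN (1 : Matrix (Fin n) (Fin n) ℝ) := by
  intro p r c hr hc
  by_cases h : ∃ s, r s ∉ Set.range c
  · obtain ⟨s, hs⟩ := h
    refine (Matrix.det_eq_zero_of_row_eq_zero s fun t => ?_).ge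
    rw [Matrix.submatrix_apply, Matrix.one_apply_ne]
    rintro e
    exact hs ⟨t, e.symm⟩
  · push Not at h
    have hrc : r = c := by
      refine (hr.range_inj hc).1 (Set.eq_of_subset_of_ncard_le ?_ ?_ (Set.toFinite _))
      · rintro _ ⟨s, rfl⟩
        exact h s
      · rw [Set.ncard_range_of_injective hr.injective, Set.ncard_range_of_injective hc.injective]
    rw [hrc, Matrix.submatrix_one _ hc.injective, Matrix.det_one]
    exact zero_le_one

theorem det_submatrix_diagonal_mul {n p : ℕ} (d : Fin n → ℝ) (M : Matrix (Fin n) (Fin n) ℝ)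
    (r c : Fin p → Fin n) :
    ((Matrix.diagonal d * M).submatrix r c).det = (∏ s, d (r s)) * (M.submatrix r c).det := by
  rw [← Matrix.det_mul_column]
  congr 1
  ext s t
  simp [Matrix.diagonal_mul]

theorem IsTN.diagonal_mul {n : ℕ} {M : Matrix (Fin n) (Fin n) ℝ} (h : IsTN M) {d : Fin n → ℝ}
    (hd : ∀ a, 0 < d a) : IsTN (Matrix.diagonal d * M) := by
  intro p r c hr hc
  rw [det_submatrix_diagonal_mul]
  exact mul_nonneg (Finset.prod_nonneg fun s _ => (hd _).le) (h p r c hr hc)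

/-- Moving one entry of a strictly monotone map one step down, to an unused value. -/
theorem StrictMono.update_pred {n p b : ℕ} (hb : b + 1 < n) {r : Fin p → Fin n}
    (hr : StrictMono r) {t : Fin p} (ht : r t = ⟨b + 1, hb⟩)
    (hnot : ∀ s, r s ≠ ⟨b, by omega⟩) : StrictMono (Function.update r t ⟨b, by omega⟩) := by
  intro s s' hss
  have h1 := hr hss
  have h2 := hnot s
  have h3 := hnot s'
  have h4 : (r t : ℕ) = b + 1 := by rw [ht]
  simp only [Function.update_apply]
  rw [Fin.lt_def] at h1 ⊢
  rw [Ne, Fin.ext_iff] at h2 h3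
  simp only at h2 h3
  split_ifs with e e' e'
  · subst e; subst e'; exact absurd hss (lt_irrefl _)
  · subst e; simp only; omega
  · subst e'; simp only; omega
  · exact h1

/-- Expansion of a minor of `elemL * N` whose row set contains the modified row. -/
theorem det_submatrix_elemL_mul {n p b : ℕ} (hb : b + 1 < n) (q : ℝ)
    (N : Matrix (Fin n) (Fin n) ℝ) {r : Fin p → Fin n} (c : Fin p → Fin n)
    (hr : StrictMono r) {t : Fin p} (ht : r t = ⟨b + 1, hb⟩) :
    ((elemL n (b + 2) q * N).submatrix r c).det = (N.submatrix r c).det +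
      q * (N.submatrix (Function.update r t ⟨b, by omega⟩) c).det := by
  have key : (elemL n (b + 2) q * N).submatrix r c =
      (N.submatrix r c).updateRow t
        ((fun s => N (r t) (c s)) + q • fun s => N ⟨b, by omega⟩ (c s)) := by
    ext s s'
    rw [elemL_eq_transvection hb]
    by_cases h : s = t
    · subst h
      simp [ht, Matrix.updateRow_self]
    · rw [Matrix.updateRow_ne h, Matrix.submatrix_apply, Matrix.submatrix_apply,
        Matrix.transvection_mul_apply_of_ne]
      rw [← ht]
      exact hr.injective.ne h
  rw [key, Matrix.det_updateRow_add, Matrix.det_updateRow_smul]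
  congr 2
  · ext s s'
    by_cases h : s = t
    · subst h; simp [Matrix.updateRow_self]
    · simp [Matrix.updateRow_ne h]
  · congr 1
    ext s s'
    by_cases h : s = t
    · subst h; simp [Matrix.updateRow_self]
    · simp [Matrix.updateRow_ne h, Function.update_of_ne h]

theorem submatrix_elemL_mul_of_forall_ne {n p b : ℕ} (hb : b + 1 < n) (q : ℝ)
    (N : Matrix (Fin n) (Fin n) ℝ) {r : Fin p → Fin n} (c : Fin p → Fin n)
    (ht : ∀ t, r t ≠ ⟨b + 1, hb⟩) :
    (elemL n (b + 2) q * N).submatrix r c = N.submatrix r c := by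
  ext s s'
  rw [elemL_eq_transvection hb, Matrix.submatrix_apply, Matrix.submatrix_apply,
    Matrix.transvection_mul_apply_of_ne _ _ _ _ (ht s)]

/-- Left multiplication by an elementary bidiagonal matrix does not decrease the minors of a
totally nonnegative matrix. -/
theorem det_submatrix_le_elemL_mul {n p : ℕ} (j : ℕ) {q : ℝ} (hq : 0 ≤ q)
    {N : Matrix (Fin n) (Fin n) ℝ} (hN : IsTN N) {r c : Fin p → Fin n}
    (hr : StrictMono r) (hc : StrictMono c) :
    (N.submatrix r c).det ≤ ((elemL n j q * N).submatrix r c).det := by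
  rcases elemL_index_cases n j with h | ⟨b, hb, rfl⟩
  · simp [elemL_eq_one h]
  · by_cases ht : ∃ t, r t = ⟨b + 1, hb⟩
    · obtain ⟨t, ht⟩ := ht
      rw [det_submatrix_elemL_mul hb q N c hr ht]
      refine le_add_of_nonneg_right (mul_nonneg hq ?_)
      -- If row b is already selected, the extra minor has two equal rows and vanishes; otherwise
      -- the changed row map is still increasing.
      by_cases hs : ∃ s, r s = ⟨b, by omega⟩
      · obtain ⟨s, hs⟩ := hs
        have hst : s ≠ t := by
          rintro rfl
          rw [ht] at hs
          simp at hs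
        refine (Matrix.det_zero_of_row_eq hst ?_).ge
        ext x
        simp [hst, hs]
      · push Not at hs
        exact hN p _ _ (hr.update_pred hb ht hs) hc
    · push Not at ht
      rw [submatrix_elemL_mul_of_forall_ne hb q N c ht]

theorem IsTN.elemL_mul {n : ℕ} (j : ℕ) {q : ℝ} (hq : 0 ≤ q)
    {N : Matrix (Fin n) (Fin n) ℝ} (hN : IsTN N) : IsTN (elemL n j q * N) :=
  fun p r c hr hc => (hN p r c hr hc).trans (det_submatrix_le_elemL_mul j hq hN hr hc)

end TotalNonnegativity

/-! ### Products of elementary matrices and their words of positive letters -/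

section Covers

/-- `Covers v M`: the matrix `M` is a product of elementary bidiagonal matrices with nonnegative
multipliers, and the indices of those with positive multipliers contain `v` as a subsequence. -/
inductive Covers {n : ℕ} : List ℕ → Matrix (Fin n) (Fin n) ℝ → Prop
  | one : Covers [] 1
  | skip {v : List ℕ} {M : Matrix (Fin n) (Fin n) ℝ} (j : ℕ) (q : ℝ) :
      0 ≤ q → Covers v M → Covers v (elemL n j q * M)
  | cons {v : List ℕ} {M : Matrix (Fin n) (Fin n) ℝ} (j : ℕ) (q : ℝ) :
      0 < q → Covers v M → Covers (j :: v) (elemL n j q * M)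

variable {n : ℕ}

theorem Covers.mul {v w : List ℕ} {M N : Matrix (Fin n) (Fin n) ℝ} (hM : Covers v M)
    (hN : Covers w N) : Covers (v ++ w) (M * N) := by
  induction hM with
  | one => simpa using hN
  | skip j q hq _ ih =>
    rw [Matrix.mul_assoc]
    exact ih.skip j q hq
  | cons j q hq _ ih =>
    rw [Matrix.mul_assoc]
    exact ih.cons j q hq

theorem Covers.of_forall_pos (v : List ℕ) (w : ℕ → ℝ) (h : ∀ j ∈ v, 0 < w j) :
    Covers v (v.map fun j => elemL n j (w j)).prod := by
  induction v with
  | nil => simpa using Covers.one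
  | cons j v ih =>
    rw [List.map_cons, List.prod_cons]
    exact (ih fun i hi => h i (List.mem_cons_of_mem _ hi)).cons j _ (h j List.mem_cons_self)

theorem Covers.of_forall_nonneg (v : List ℕ) (w : ℕ → ℝ) (h : ∀ j ∈ v, 0 ≤ w j) :
    Covers [] (v.map fun j => elemL n j (w j)).prod := by
  induction v with
  | nil => simpa using Covers.one
  | cons j v ih =>
    rw [List.map_cons, List.prod_cons]
    exact (ih fun i hi => h i (List.mem_cons_of_mem _ hi)).skip j _ (h j List.mem_cons_self)

theorem Covers.flatMap (v : List ℕ) (w : ℕ → List ℕ) (B : ℕ → Matrix (Fin n) (Fin n) ℝ)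
    (h : ∀ i ∈ v, Covers (w i) (B i)) : Covers (v.flatMap w) (v.map B).prod := by
  induction v with
  | nil => simpa using Covers.one
  | cons i v ih =>
    rw [List.map_cons, List.prod_cons, List.flatMap_cons]
    exact (h i List.mem_cons_self).mul (ih fun j hj => h j (List.mem_cons_of_mem _ hj))

theorem Covers.isTN_mul {v : List ℕ} {M N : Matrix (Fin n) (Fin n) ℝ} (hM : Covers v M)
    (hN : IsTN N) : IsTN (M * N) := by
  induction hM with
  | one => simpa using hN
  | skip j q hq _ ih =>
    rw [Matrix.mul_assoc]
    exact ih.elemL_mul j hq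
  | cons j q hq _ ih =>
    rw [Matrix.mul_assoc]
    exact ih.elemL_mul j hq.le

theorem Covers.isTN {v : List ℕ} {M : Matrix (Fin n) (Fin n) ℝ} (hM : Covers v M) : IsTN M := by
  simpa using hM.isTN_mul (isTN_one n)

theorem Covers.det {v : List ℕ} {M : Matrix (Fin n) (Fin n) ℝ} (hM : Covers v M) :
    M.det = 1 := by
  induction hM with
  | one => simp
  | skip j q hq _ ih => rw [Matrix.det_mul, ih, det_elemL, one_mul]
  | cons j q hq _ ih => rw [Matrix.det_mul, ih, det_elemL, one_mul]

theorem blockTriangular_transpose_elemL (j : ℕ) (q : ℝ) :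
    (elemL n j q).transpose.BlockTriangular id :=
  fun _ _ h => elemL_apply_of_lt j q h

theorem Covers.blockTriangular_transpose {v : List ℕ} {M : Matrix (Fin n) (Fin n) ℝ}
    (hM : Covers v M) : M.transpose.BlockTriangular id := by
  induction hM with
  | one => rw [Matrix.transpose_one]; exact Matrix.blockTriangular_one
  | skip j q hq _ ih =>
    rw [Matrix.transpose_mul]
    exact ih.mul (blockTriangular_transpose_elemL j q)
  | cons j q hq _ ih =>
    rw [Matrix.transpose_mul]
    exact ih.mul (blockTriangular_transpose_elemL j q)

end Covers

/-! ### Moving diagonal and upper factors past lower ones -/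

section Exchange

variable {n : ℕ}

theorem diagonal_one_fun : Matrix.diagonal (1 : Fin n → ℝ) = 1 := Matrix.diagonal_one

theorem diagonal_mul_elemL (j : ℕ) (q : ℝ) {d : Fin n → ℝ} (hd : ∀ a, 0 < d a) :
    ∃ e : ℝ, 0 < e ∧
      Matrix.diagonal d * elemL n j q = elemL n j (q * e) * Matrix.diagonal d := by
  rcases elemL_index_cases n j with h | ⟨b, hb, rfl⟩
  · exact ⟨1, one_pos, by simp [elemL_eq_one h]⟩
  · refine ⟨d ⟨b + 1, hb⟩ / d ⟨b, by omega⟩, div_pos (hd _) (hd _), ?_⟩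
    ext x y
    rw [elemL_eq_transvection hb, elemL_eq_transvection hb, Matrix.diagonal_mul, Matrix.mul_diagonal]
    have := (hd ⟨b, by omega⟩).ne'
    simp only [Matrix.transvection, Matrix.add_apply, Matrix.single_apply, Matrix.one_apply]
    split_ifs with h1 h2 h2
    · exact absurd (h2.1.trans (h1.trans h2.2.symm)) (by simp [Fin.ext_iff])
    · subst h1; ring
    · rw [← h2.1, ← h2.2]; field_simp; ring
    · ring

/-- Conjugation by a positive diagonal matrix only rescales multipliers by positive numbers, so the
word survives. -/
theorem Covers.diagonal_mul {v : List ℕ} {M : Matrix (Fin n) (Fin n) ℝ} (hM : Covers v M)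
    {d : Fin n → ℝ} (hd : ∀ a, 0 < d a) :
    ∃ M', Covers v M' ∧ Matrix.diagonal d * M = M' * Matrix.diagonal d := by
  induction hM with
  | one => exact ⟨1, .one, by simp⟩
  | skip j q hq _ ih =>
    obtain ⟨M', hM', h⟩ := ih
    obtain ⟨e, he, h'⟩ := diagonal_mul_elemL j q hd
    exact ⟨_, hM'.skip j (q * e) (by positivity), by
      rw [← Matrix.mul_assoc, h', Matrix.mul_assoc, h, Matrix.mul_assoc]⟩
  | cons j q hq _ ih =>
    obtain ⟨M', hM', h⟩ := ih
    obtain ⟨e, he, h'⟩ := diagonal_mul_elemL j q hd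
    exact ⟨_, hM'.cons j (q * e) (by positivity), by
      rw [← Matrix.mul_assoc, h', Matrix.mul_assoc, h, Matrix.mul_assoc]⟩

theorem Covers.transpose_mul_diagonal {v : List ℕ} {M : Matrix (Fin n) (Fin n) ℝ}
    (hM : Covers v M) {d : Fin n → ℝ} (hd : ∀ a, 0 < d a) :
    ∃ M', Covers v M' ∧
      M.transpose * Matrix.diagonal d = Matrix.diagonal d * M'.transpose := by
  obtain ⟨M', hM', h⟩ := hM.diagonal_mul hd
  refine ⟨M', hM', ?_⟩
  have := congrArg Matrix.transpose h
  simpa [Matrix.transpose_mul] using this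

/-- The products E_{i-1,i} E_{j,j-1} and E_{j,j-1} E_{i-1,i} both vanish for i ≠ j. -/
theorem elemU_mul_elemL_of_ne {i j : ℕ} (hij : i ≠ j) (a q : ℝ) :
    elemU n i a * elemL n j q = elemL n j q * elemU n i a := by
  rcases elemL_index_cases n j with h | ⟨b, hb, rfl⟩
  · simp [elemL_eq_one h]
  rcases elemL_index_cases n i with h | ⟨b', hb', rfl⟩
  · simp [elemU, elemL_eq_one h]
  have h1 : b ≠ b' := by omega
  simp [elemU, elemL_eq_transvection hb, elemL_eq_transvection hb', Matrix.transvection,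
    Matrix.add_mul, Matrix.mul_add, h1, h1.symm]
  abel

/-- This is the LDU factorization of the 2 × 2 matrix with rows (1 + aq, a) and (q, 1), in the
coordinates y, x; its determinant 1 forces the pivots 1 + aq and its inverse. -/
theorem transpose_transvection_mul_transvection {x y : Fin n} (hxy : x ≠ y) {a q : ℝ}
    (h : 1 + a * q ≠ 0) :
    Matrix.transvection y x a * Matrix.transvection x y q =
      Matrix.transvection x y (q / (1 + a * q)) *
        (Matrix.diagonal (Function.update (Function.update 1 y (1 + a * q)) x (1 + a * q)⁻¹) *
          Matrix.transvection y x (a / (1 + a * q))) := by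
  ext s t
  by_cases hs : s = x
  · subst hs
    rw [Matrix.transvection_mul_apply_of_ne _ _ _ _ hxy, Matrix.transvection_mul_apply_same,
      Matrix.diagonal_mul, Matrix.diagonal_mul, Function.update_self,
      Function.update_of_ne hxy.symm, Function.update_self]
    simp only [Matrix.transvection, Matrix.add_apply, Matrix.single_apply, Matrix.one_apply]
    by_cases ht : s = t
    · subst ht
      simp [hxy.symm]
      field_simp
    · by_cases ht' : y = t
      · subst ht'
        simp [hxy, hxy.symm]
        field_simp
        rw [mul_comm q a, mul_div_cancel_right₀ _ h]
      · simp [ht, ht']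
  · rw [Matrix.transvection_mul_apply_of_ne _ _ s t hs (q / (1 + a * q)), Matrix.diagonal_mul,
      Function.update_of_ne hs]
    by_cases hs' : s = y
    · subst hs'
      rw [Matrix.transvection_mul_apply_same, Function.update_self]
      simp only [Matrix.transvection, Matrix.add_apply, Matrix.single_apply, Matrix.one_apply]
      by_cases ht : x = t
      · subst ht
        simp [hxy.symm]
        field_simp
      · by_cases ht' : s = t
        · subst ht'
          simp [hxy]
        · simp [ht, ht']
    · rw [Matrix.transvection_mul_apply_of_ne _ _ _ _ hs', Function.update_of_ne hs']
      simp [Matrix.transvection, Ne.symm hs, Ne.symm hs']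

/-- An upper and a lower elementary bidiagonal matrix can be interchanged at the expense of a
diagonal matrix. -/
theorem elemU_mul_elemL (i j : ℕ) {a q : ℝ} (ha : 0 ≤ a) (hq : 0 ≤ q) :
    ∃ (e : ℝ) (d : Fin n → ℝ), 0 < e ∧ (∀ x, 0 < d x) ∧
      elemU n i a * elemL n j q =
        elemL n j (q * e) * (Matrix.diagonal d * elemU n i (a * e)) := by
  by_cases hij : i = j
  · subst hij
    rcases elemL_index_cases n i with h | ⟨b, hb, rfl⟩
    · exact ⟨1, 1, one_pos, fun _ => one_pos, by
        rw [diagonal_one_fun]; simp [elemU, elemL_eq_one h]⟩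
    have hpos : 0 < 1 + a * q := by positivity
    refine ⟨(1 + a * q)⁻¹, Function.update (Function.update 1 ⟨b, by omega⟩ (1 + a * q))
      ⟨b + 1, hb⟩ (1 + a * q)⁻¹, inv_pos.2 hpos, fun x => ?_, ?_⟩
    · simp only [Function.update_apply]
      split_ifs
      · exact inv_pos.2 hpos
      · exact hpos
      · exact one_pos
    · have := transpose_transvection_mul_transvection
        (x := (⟨b + 1, hb⟩ : Fin n)) (y := ⟨b, by omega⟩) (by simp [Fin.ext_iff]) hpos.ne'
      simp only [elemU, elemL_eq_transvection hb, ← div_eq_mul_inv]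
      simpa [Matrix.transvection, Matrix.transpose_add, Matrix.transpose_single] using this
  · refine ⟨1, 1, one_pos, fun _ => one_pos, ?_⟩
    rw [diagonal_one_fun, elemU_mul_elemL_of_ne hij, mul_one, mul_one, Matrix.one_mul]

theorem Covers.elemU_mul {v : List ℕ} {L : Matrix (Fin n) (Fin n) ℝ} (hL : Covers v L) (i : ℕ)
    {a : ℝ} (ha : 0 ≤ a) :
    ∃ (L' : Matrix (Fin n) (Fin n) ℝ) (d : Fin n → ℝ) (e : ℝ),
      Covers v L' ∧ (∀ x, 0 < d x) ∧ 0 < e ∧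
      elemU n i a * L = L' * (Matrix.diagonal d * elemU n i (a * e)) := by
  induction hL generalizing a with
  | one => exact ⟨1, 1, 1, .one, fun _ => one_pos, one_pos, by
      rw [diagonal_one_fun]; simp⟩
  | skip j q hq _ ih =>
    obtain ⟨e, d, he, hd, h⟩ := elemU_mul_elemL (n := n) i j ha hq
    obtain ⟨L', d', e', hL', hd', he', h'⟩ := ih (a := a * e) (by positivity)
    obtain ⟨L'', hL'', h''⟩ := hL'.diagonal_mul hd
    refine ⟨_, d * d', e * e', hL''.skip j (q * e) (by positivity),
      fun x => mul_pos (hd x) (hd' x), mul_pos he he', ?_⟩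
    rw [← Matrix.mul_assoc, h, Matrix.mul_assoc, Matrix.mul_assoc, h', ← Matrix.mul_assoc _ L',
      h'', ← mul_assoc a e e']
    have : Matrix.diagonal (d * d') = Matrix.diagonal d * Matrix.diagonal d' := by
      rw [Matrix.diagonal_mul_diagonal]; rfl
    rw [this]
    simp only [Matrix.mul_assoc]
  | cons j q hq _ ih =>
    obtain ⟨e, d, he, hd, h⟩ := elemU_mul_elemL (n := n) i j ha hq.le
    obtain ⟨L', d', e', hL', hd', he', h'⟩ := ih (a := a * e) (by positivity)
    obtain ⟨L'', hL'', h''⟩ := hL'.diagonal_mul hd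
    refine ⟨_, d * d', e * e', hL''.cons j (q * e) (by positivity),
      fun x => mul_pos (hd x) (hd' x), mul_pos he he', ?_⟩
    rw [← Matrix.mul_assoc, h, Matrix.mul_assoc, Matrix.mul_assoc, h', ← Matrix.mul_assoc _ L',
      h'', ← mul_assoc a e e']
    have : Matrix.diagonal (d * d') = Matrix.diagonal d * Matrix.diagonal d' := by
      rw [Matrix.diagonal_mul_diagonal]; rfl
    rw [this]
    simp only [Matrix.mul_assoc]

end Exchange

/-! ### Particle paths and positivity of minors -/

section Paths

/-- `ParticlePath v a b`: reading `v` from left to right, the particles at the (one-based) positions `a`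
can be moved to the positions `b`, where a letter `j` allows a particle to move from `j` to the
vacant position `j - 1`. -/
inductive ParticlePath {p : ℕ} : List ℕ → (Fin p → ℕ) → (Fin p → ℕ) → Prop
  | nil (a : Fin p → ℕ) : ParticlePath [] a a
  | skip {v : List ℕ} {a b : Fin p → ℕ} (j : ℕ) : ParticlePath v a b → ParticlePath (j :: v) a b
  | move {v : List ℕ} {a b : Fin p → ℕ} (x : ℕ) (t : Fin p) : a t = x + 2 → (∀ s, a s ≠ x + 1) →
      ParticlePath v (Function.update a t (x + 1)) b → ParticlePath ((x + 2) :: v) a b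

variable {n p : ℕ}

theorem ParticlePath.append {v w : List ℕ} {a b c : Fin p → ℕ} (h : ParticlePath v a b) (h' : ParticlePath w b c) :
    ParticlePath (v ++ w) a c := by
  induction h with
  | nil => exact h'
  | skip j _ ih => exact (ih h').skip j
  | move x t h1 h2 _ ih => exact (ih h').move x t h1 h2

theorem ParticlePath.mono {v w : List ℕ} {a b : Fin p → ℕ} (h : ParticlePath v a b) (hvw : v.Sublist w) :
    ParticlePath w a b := by
  induction hvw generalizing a with
  | slnil => exact h
  | cons j _ ih => exact (ih h).skip j
  | cons_cons j _ ih =>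
    cases h with
    | skip _ h => exact (ih h).skip j
    | move x t h1 h2 h => exact (ih h).move x t h1 h2

theorem ParticlePath.refl (v : List ℕ) (a : Fin p → ℕ) : ParticlePath v a a :=
  (ParticlePath.nil a).mono (List.nil_sublist v)

/-- Paths transfer the positivity of minors. -/
theorem Covers.det_submatrix_mul_pos {v : List ℕ} {L N : Matrix (Fin n) (Fin n) ℝ}
    (hL : Covers v L) (hN : IsTN N) {a b : Fin p → ℕ} (h : ParticlePath v a b) {r r' c : Fin p → Fin n}
    (hr : StrictMono r) (hc : StrictMono c)
    (hra : ∀ s, (r s : ℕ) + 1 = a s) (hrb : ∀ s, (r' s : ℕ) + 1 = b s)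
    (hpos : 0 < (N.submatrix r' c).det) : 0 < ((L * N).submatrix r c).det := by
  induction hL generalizing a r with
  | one =>
    cases h
    have : r = r' := by
      ext s
      have := hra s
      have := hrb s
      omega
    rwa [Matrix.one_mul, this]
  | skip j q hq hM ih =>
    rw [Matrix.mul_assoc]
    exact (ih h hr hra).trans_le (det_submatrix_le_elemL_mul j hq (hM.isTN_mul hN) hr hc)
  | cons j q hq hM ih =>
    rw [Matrix.mul_assoc]
    cases h with
    | skip _ h =>
      exact (ih h hr hra).trans_le (det_submatrix_le_elemL_mul j hq.le (hM.isTN_mul hN) hr hc)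
    | move x t h1 h2 h =>
      have hb : x + 1 < n := by
        have := hra t
        have := (r t).isLt
        omega
      have ht : r t = ⟨x + 1, hb⟩ := by
        have := hra t
        rw [Fin.ext_iff]
        simp only
        omega
      have hnot : ∀ s, r s ≠ ⟨x, by omega⟩ := by
        intro s hs
        have := hra s
        rw [Fin.ext_iff] at hs
        simp only at hs
        have := h2 s
        omega
      rw [det_submatrix_elemL_mul hb q _ c hr ht]
      refine add_pos_of_nonneg_of_pos (hM.isTN_mul hN p r c hr hc) (mul_pos hq ?_)
      refine ih h (hr.update_pred hb ht hnot) fun s => ?_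
      by_cases hs : s = t
      · subst hs; simp
      · simpa [Function.update_of_ne hs] using hra s

/-- If all configurations can be moved to the lowest one along `v` and along `w`, then a matrix
`L D U` with `L` and `Uᵀ` covering `v` and `w` is totally positive. -/
theorem isTP_of_covers {v w : List ℕ} {L U : Matrix (Fin n) (Fin n) ℝ} (hL : Covers v L)
    (hU : Covers w U) {d : Fin n → ℝ} (hd : ∀ x, 0 < d x)
    (hv : ∀ (p : ℕ) (a : Fin p → ℕ), StrictMono a → (∀ s, 1 ≤ a s) → (∀ s, a s ≤ n) →
      ParticlePath v a fun s => (s : ℕ) + 1)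
    (hw : ∀ (p : ℕ) (a : Fin p → ℕ), StrictMono a → (∀ s, 1 ≤ a s) → (∀ s, a s ≤ n) →
      ParticlePath w a fun s => (s : ℕ) + 1) :
    IsTP (L * (Matrix.diagonal d * U.transpose)) := by
  intro p r c hr hc
  have hp : p ≤ n := by simpa using Fintype.card_le_of_injective r hr.injective
  have he : StrictMono (Fin.castLE hp) := Fin.strictMono_castLE hp
  have path {u : List ℕ} (hu : ∀ (p : ℕ) (a : Fin p → ℕ), StrictMono a → (∀ s, 1 ≤ a s) →
      (∀ s, a s ≤ n) → ParticlePath u a fun s => (s : ℕ) + 1) {f : Fin p → Fin n} (hf : StrictMono f) :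
      ParticlePath u (fun s => (f s : ℕ) + 1) fun s => (s : ℕ) + 1 :=
    hu p _ (fun s t hst => Nat.succ_lt_succ (hf hst)) (fun s => by omega) fun s => (f s).isLt
  -- L lowers the rows to the first p. The remaining minor is, up to positive diagonal entries, the
  -- transpose of a minor of U, whose rows are lowered in the same way to a principal minor of the
  -- identity.
  refine hL.det_submatrix_mul_pos (r' := Fin.castLE hp) (hU.isTN.transpose.diagonal_mul hd) (path hv hr) hr hc
    (fun _ => rfl) (fun _ => rfl) ?_
  rw [det_submatrix_diagonal_mul, ← Matrix.transpose_submatrix, Matrix.det_transpose]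
  refine mul_pos (Finset.prod_pos fun s _ => hd _) ?_
  have := hU.det_submatrix_mul_pos (r' := Fin.castLE hp) (isTN_one n) (path hw hc) hc he
    (fun _ => rfl) (fun _ => rfl) (by
      rw [Matrix.submatrix_one _ he.injective, Matrix.det_one]; exact one_pos)
  rwa [Matrix.mul_one] at this

end Paths

/-! ### Factorization of products -/

section Products

variable {n : ℕ}

/-- A matrix `Uᵀ D L` can be rewritten as `L' D' U'ᵀ`, with the same positive factors. -/
theorem Covers.transpose_mul_mul {v w : List ℕ} {L U : Matrix (Fin n) (Fin n) ℝ}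
    (hU : Covers w U) (hL : Covers v L) :
    ∃ (L' U' : Matrix (Fin n) (Fin n) ℝ) (d : Fin n → ℝ), Covers v L' ∧ Covers w U' ∧
      (∀ x, 0 < d x) ∧ U.transpose * L = L' * (Matrix.diagonal d * U'.transpose) := by
  induction hU generalizing L with
  | one => exact ⟨L, 1, 1, hL, .one, fun _ => one_pos, by rw [diagonal_one_fun]; simp⟩
  | @skip w M j q hq _ ih =>
    obtain ⟨L₁, d₁, e, hL₁, hd₁, he, h₁⟩ := hL.elemU_mul j hq
    obtain ⟨L₂, U₂, d₂, hL₂, hU₂, hd₂, h₂⟩ := ih hL₁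
    obtain ⟨U₃, hU₃, h₃⟩ := hU₂.transpose_mul_diagonal hd₁
    refine ⟨L₂, elemL n j (q * e) * U₃, d₂ * d₁, hL₂, hU₃.skip _ _ (by positivity),
      fun x => mul_pos (hd₂ x) (hd₁ x), ?_⟩
    have hd : Matrix.diagonal (d₂ * d₁) = Matrix.diagonal d₂ * Matrix.diagonal d₁ := by
      rw [Matrix.diagonal_mul_diagonal]; rfl
    calc (elemL n j q * M).transpose * L = M.transpose * (elemU n j q * L) := by
          rw [Matrix.transpose_mul, Matrix.mul_assoc]; rfl
      _ = L₂ * (Matrix.diagonal d₂ * ((U₂.transpose * Matrix.diagonal d₁) *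
            elemU n j (q * e))) := by
          rw [h₁, ← Matrix.mul_assoc, h₂]; simp only [Matrix.mul_assoc]
      _ = _ := by
          rw [h₃, hd, Matrix.transpose_mul]; simp only [Matrix.mul_assoc]; rfl
  | @cons w M j q hq _ ih =>
    obtain ⟨L₁, d₁, e, hL₁, hd₁, he, h₁⟩ := hL.elemU_mul j hq.le
    obtain ⟨L₂, U₂, d₂, hL₂, hU₂, hd₂, h₂⟩ := ih hL₁
    obtain ⟨U₃, hU₃, h₃⟩ := hU₂.transpose_mul_diagonal hd₁
    refine ⟨L₂, elemL n j (q * e) * U₃, d₂ * d₁, hL₂, hU₃.cons _ _ (by positivity),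
      fun x => mul_pos (hd₂ x) (hd₁ x), ?_⟩
    have hd : Matrix.diagonal (d₂ * d₁) = Matrix.diagonal d₂ * Matrix.diagonal d₁ := by
      rw [Matrix.diagonal_mul_diagonal]; rfl
    calc (elemL n j q * M).transpose * L = M.transpose * (elemU n j q * L) := by
          rw [Matrix.transpose_mul, Matrix.mul_assoc]; rfl
      _ = L₂ * (Matrix.diagonal d₂ * ((U₂.transpose * Matrix.diagonal d₁) *
            elemU n j (q * e))) := by
          rw [h₁, ← Matrix.mul_assoc, h₂]; simp only [Matrix.mul_assoc]
      _ = _ := by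
          rw [h₃, hd, Matrix.transpose_mul]; simp only [Matrix.mul_assoc]; rfl

/-- `X = L D Uᵀ` with `L ∈ S`, `U ∈ T` and a positive diagonal matrix `D`. -/
def HasFactors (S T : Set (Matrix (Fin n) (Fin n) ℝ)) (X : Matrix (Fin n) (Fin n) ℝ) : Prop :=
  ∃ (L U : Matrix (Fin n) (Fin n) ℝ) (d : Fin n → ℝ), L ∈ S ∧ U ∈ T ∧ (∀ x, 0 < d x) ∧
    X = L * (Matrix.diagonal d * U.transpose)

theorem HasFactors.transpose {S T : Set (Matrix (Fin n) (Fin n) ℝ)}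
    {X : Matrix (Fin n) (Fin n) ℝ} (h : HasFactors S T X) : HasFactors T S X.transpose := by
  obtain ⟨L, U, d, hL, hU, hd, rfl⟩ := h
  exact ⟨U, L, d, hU, hL, hd, by simp [Matrix.transpose_mul, Matrix.mul_assoc]⟩

/-- Interchanging U₁ᵀ with L₂ brings the lower factors together. The upper words appear in reverse
order since U₁ᵀ U₂ᵀ = (U₂ U₁)ᵀ. -/
theorem HasFactors.mul {v₁ w₁ v₂ w₂ : List ℕ} {X Y : Matrix (Fin n) (Fin n) ℝ}
    (hX : HasFactors {M | Covers v₁ M} {M | Covers w₁ M} X)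
    (hY : HasFactors {M | Covers v₂ M} {M | Covers w₂ M} Y) :
    HasFactors {M | Covers (v₁ ++ v₂) M} {M | Covers (w₂ ++ w₁) M} (X * Y) := by
  obtain ⟨L₁, U₁, d₁, hL₁, hU₁, hd₁, rfl⟩ := hX
  obtain ⟨L₂, U₂, d₂, hL₂, hU₂, hd₂, rfl⟩ := hY
  obtain ⟨L, U, d, hL, hU, hd, h⟩ := Covers.transpose_mul_mul hU₁ hL₂
  obtain ⟨L', hL', h₁⟩ := Covers.diagonal_mul hL hd₁
  obtain ⟨U', hU', h₂⟩ := Covers.transpose_mul_diagonal hU hd₂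
  refine ⟨L₁ * L', U₂ * U', d₁ * d * d₂, Covers.mul hL₁ hL', Covers.mul hU₂ hU',
    fun x => mul_pos (mul_pos (hd₁ x) (hd x)) (hd₂ x), ?_⟩
  have hdd : Matrix.diagonal (d₁ * d * d₂) =
      Matrix.diagonal d₁ * (Matrix.diagonal d * Matrix.diagonal d₂) := by
    rw [Matrix.diagonal_mul_diagonal, Matrix.diagonal_mul_diagonal, mul_assoc]; rfl
  calc L₁ * (Matrix.diagonal d₁ * U₁.transpose) * (L₂ * (Matrix.diagonal d₂ * U₂.transpose))
      = L₁ * (Matrix.diagonal d₁ * ((U₁.transpose * L₂) *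
          (Matrix.diagonal d₂ * U₂.transpose))) := by simp only [Matrix.mul_assoc]
    _ = L₁ * ((Matrix.diagonal d₁ * L) * (Matrix.diagonal d *
          ((U.transpose * Matrix.diagonal d₂) * U₂.transpose))) := by
        rw [h]; simp only [Matrix.mul_assoc]
    _ = _ := by
        rw [h₁, h₂, hdd, Matrix.transpose_mul]; simp only [Matrix.mul_assoc]

theorem HasFactors.list_prod {v w : List ℕ} (l : List (Matrix (Fin n) (Fin n) ℝ))
    (h : ∀ X ∈ l, HasFactors {M | Covers v M} {M | Covers w M} X) :
    HasFactors {M | Covers (List.replicate l.length v).flatten M}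
      {M | Covers (List.replicate l.length w).flatten M} l.prod := by
  induction l with
  | nil => exact ⟨1, 1, 1, .one, .one, fun _ => one_pos, by rw [diagonal_one_fun]; simp⟩
  | cons X l ih =>
    rw [List.prod_cons, List.length_cons]
    have := (h X List.mem_cons_self).mul (ih fun Y hY => h Y (List.mem_cons_of_mem _ hY))
    have hw : w ++ (List.replicate l.length w).flatten =
        (List.replicate l.length w).flatten ++ w := by
      rw [← List.flatten_cons, ← List.replicate_succ, List.replicate_succ', List.flatten_append,
        List.flatten_singleton]
    rwa [List.replicate_succ, List.replicate_succ, List.flatten_cons, List.flatten_cons, hw]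

end Products

/-! ### Particle paths along the words of the two classes -/

section Words

variable {n p : ℕ}

/-- The letters of the block `W_i`. -/
def wordW (n i : ℕ) : List ℕ := (List.range' i (n + 1 - i)).reverse

theorem Covers.blockW {i : ℕ} {w : ℕ → ℝ} (h : ∀ j, i ≤ j → j ≤ n → 0 < w j) :
    Covers (wordW n i) (blockW n i w) := by
  refine Covers.of_forall_pos (wordW n i) w fun j hj => ?_
  rw [wordW, List.mem_reverse, List.mem_range'_1] at hj
  exact h j hj.1 (by omega)

/-- A particle can be moved down to any position above the particles below it. -/
theorem ParticlePath.descend {a : Fin p → ℕ} (ha : StrictMono a) (t : Fin p) (x : ℕ) (hx : 1 ≤ x)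
    (h : ∀ s < t, a s < x) (e : ℕ) (he : a t = x + e) :
    ParticlePath (List.range' (x + 1) e).reverse a (Function.update a t x) := by
  induction e generalizing a with
  | zero =>
    have : Function.update a t x = a := by simp [← show a t = x by omega]
    rw [this]
    exact .nil a
  | succ e ih =>
    rw [List.range'_1_concat, List.reverse_append]
    -- The leading letter is put in the form y + 2 required by `move`; the subtraction is harmless
    -- because x ≥ 1.
    have hx' : x + 1 + e = x + e - 1 + 2 := by omega
    have hx'' : x + e - 1 + 1 = x + e := by omega
    simp only [List.reverse_singleton, List.singleton_append]
    rw [hx']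
    have hmono : StrictMono (Function.update a t (x + e)) := by
      intro s s' hss
      have h1 := ha hss
      simp only [Function.update_apply]
      split_ifs with e1 e2 e2
      · subst e1; subst e2; exact absurd hss (lt_irrefl _)
      · subst e1; omega
      · subst e2; have := h s hss; omega
      · exact h1
    refine ParticlePath.move _ t (by omega) (fun s => ?_) ?_
    · rcases lt_trichotomy s t with hs | hs | hs
      · have := h s hs; omega
      · subst hs; omega
      · have := ha hs; omega
    · rw [hx'']
      have := ih hmono (fun s hs => by rw [Function.update_of_ne hs.ne]; exact h s hs) (by simp)
      simpa using this

/-- The configuration in which the first `c` particles have been moved to `r + 1, r + 2, …`, or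
stayed in place if they were lower. -/
def partialSort (r : ℕ) (a : Fin p → ℕ) (c : ℕ) (s : Fin p) : ℕ :=
  if (s : ℕ) < c then min (a s) (s + 1 + r) else a s

theorem strictMono_partialSort (r : ℕ) {a : Fin p → ℕ} (ha : StrictMono a) (c : ℕ) :
    StrictMono (partialSort r a c) := by
  intro s t hst
  have h1 := ha hst
  have h2 : (s : ℕ) < t := hst
  simp only [partialSort]
  split_ifs <;> omega

theorem partialSort_succ (r : ℕ) (a : Fin p → ℕ) (t : Fin p) :
    partialSort r a (t + 1) = Function.update (partialSort r a t) t (min (a t) (t + 1 + r)) := by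
  ext s
  by_cases h : s = t
  · subst h; simp [partialSort]
  · have : (s : ℕ) ≠ t := fun e => h (Fin.ext e)
    rw [Function.update_of_ne h]
    simp only [partialSort]
    split_ifs <;> omega

/-- One block, read downwards from n, carries the next particle all the way to c + 1 + r. The last
letter this needs is c + 2 + r, whence the bound on i. -/
theorem path_wordW_partialSort (r : ℕ) {a : Fin p → ℕ} (ha : StrictMono a) (han : ∀ s, a s ≤ n)
    (ha1 : ∀ s, 1 ≤ a s) (c i : ℕ) (hi : i ≤ r + 2 + c) :
    ParticlePath (wordW n i) (partialSort r a c) (partialSort r a (c + 1)) := by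
  by_cases hc : c < p
  · have key := partialSort_succ r a ⟨c, hc⟩
    simp only at key
    rw [key]
    set m := min (a ⟨c, hc⟩) (c + 1 + r) with hm
    have hac := han ⟨c, hc⟩
    have hself : partialSort r a c ⟨c, hc⟩ = a ⟨c, hc⟩ := by simp [partialSort]
    by_cases hle : a ⟨c, hc⟩ ≤ c + 1 + r
    · have : Function.update (partialSort r a c) ⟨c, hc⟩ m = partialSort r a c := by
        rw [Function.update_eq_self_iff, hself, hm]
        omega
      rw [this]
      exact ParticlePath.refl _ _
    · refine (ParticlePath.descend (strictMono_partialSort r ha c) ⟨c, hc⟩ m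
        (by have := ha1 ⟨c, hc⟩; omega) (fun s hs => ?_) (a ⟨c, hc⟩ - m)
        (by rw [hself]; omega)).mono ?_
      · have h1 := ha hs
        have h2 : (s : ℕ) < c := hs
        simp only [partialSort]
        split_ifs
        omega
      · rw [wordW, List.reverse_sublist]
        -- The letters m + 1, …, a_c used by the descent form a segment of i, …, n.
        have : List.range' i (n + 1 - i) = List.range' i (m + 1 - i) ++
            (List.range' (m + 1) (a ⟨c, hc⟩ - m) ++
              List.range' (a ⟨c, hc⟩ + 1) (n - a ⟨c, hc⟩)) := by
          have h1 : a ⟨c, hc⟩ + 1 = m + 1 + (a ⟨c, hc⟩ - m) := by omega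
          rw [h1, List.range'_append_1]
          have h2 : m + 1 = i + (m + 1 - i) := by omega
          conv_rhs => rw [h2]
          rw [show i + (m + 1 - i) - i = m + 1 - i by omega, List.range'_append_1]
          congr 1
          omega
        rw [this]
        exact (List.sublist_append_left _ _).trans (List.sublist_append_right _ _)
  · have : partialSort r a (c + 1) = partialSort r a c := by
      ext s
      have := s.isLt
      simp only [partialSort]
      split_ifs <;> omega
    rw [this]
    exact ParticlePath.refl _ _

theorem path_flatMap_wordW_partialSort (r : ℕ) {a : Fin p → ℕ} (ha : StrictMono a)
    (han : ∀ s, a s ≤ n) (ha1 : ∀ s, 1 ≤ a s) (m c i : ℕ) (hi : i ≤ r + 2 + c) :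
    ParticlePath ((List.range' i m).flatMap (wordW n)) (partialSort r a c) (partialSort r a (c + m)) := by
  induction m with
  | zero => exact .nil _
  | succ m ih =>
    rw [List.range'_1_concat, List.flatMap_append, List.flatMap_singleton]
    exact ih.append (path_wordW_partialSort r ha han ha1 (c + m) (i + m) (by omega))

theorem add_one_le_of_strictMono {a : Fin p → ℕ} (ha : StrictMono a) (ha1 : ∀ s, 1 ≤ a s) :
    ∀ s : Fin p, (s : ℕ) + 1 ≤ a s := by
  rintro ⟨s, hs⟩
  induction s with
  | zero => exact ha1 _
  | succ s ih =>
    have h1 := ih (by omega)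
    have h2 : a ⟨s, by omega⟩ < a ⟨s + 1, hs⟩ := ha (by simp [Fin.lt_def])
    simp only at h1 ⊢
    omega

theorem partialSort_zero (r : ℕ) (a : Fin p → ℕ) : partialSort r a 0 = a := by
  ext s
  simp [partialSort]

theorem ParticlePath.replicate_flatten {v : List ℕ} (f : ℕ → Fin p → ℕ) (k : ℕ)
    (h : ∀ t, ParticlePath v (f t) (f (t + 1))) : ParticlePath (List.replicate k v).flatten (f 0) (f k) := by
  induction k with
  | zero => exact .nil _
  | succ k ih =>
    rw [List.replicate_succ', List.flatten_append, List.flatten_singleton]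
    exact ih.append (h k)

/-- The letters of the matrices in `Z_1(s)`. -/
def wordZ1 (n s : ℕ) : List ℕ := (List.range' 2 (s - 1)).flatMap (wordW n)

/-- After t copies the first t(s-1) particles are home. With n-1 particles home, a possible n-th one
can only be at n. -/
theorem path_wordZ1 {s k : ℕ} (hk : n ≤ 1 + k * (s - 1)) {a : Fin p → ℕ} (ha : StrictMono a)
    (ha1 : ∀ t, 1 ≤ a t) (han : ∀ t, a t ≤ n) :
    ParticlePath (List.replicate k (wordZ1 n s)).flatten a fun t => (t : ℕ) + 1 := by
  have := ParticlePath.replicate_flatten (v := wordZ1 n s) (fun t => partialSort 0 a (t * (s - 1))) k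
    fun t => by
      rw [Nat.succ_mul]
      exact path_flatMap_wordW_partialSort 0 ha han ha1 (s - 1) _ 2 (by omega)
  simp only [Nat.zero_mul, partialSort_zero] at this
  convert this using 1
  ext t
  have h1 := add_one_le_of_strictMono ha ha1 t
  have h2 := han t
  simp only [partialSort]
  split_ifs <;> omega

/-- Common letters of the matrices in `Z_2(s)`. -/
def wordZ2 (n s : ℕ) : List ℕ :=
  List.range' 2 (s - 2) ++ (List.range' s (n + 1 - s)).flatMap (wordW n)

theorem range'_sublist_wordZ2 {s : ℕ} (hs : 2 ≤ s) (hsn : s ≤ n) :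
    (List.range' 2 (n - 1)).Sublist (wordZ2 n s) := by
  have h1 : List.range' 2 (n - 1) = List.range' 2 (s - 2) ++ List.range' s (n + 1 - s) := by
    have : s = 2 + (s - 2) := by omega
    conv_rhs => rw [this]
    rw [show 2 + (s - 2) - 2 = s - 2 by omega, List.range'_append_1]
    congr 1
    omega
  rw [h1, wordZ2]
  refine (List.Sublist.refl _).append ?_
  have h2 : ∀ l : List ℕ, (∀ i ∈ l, i ≤ n) → l.Sublist (l.flatMap (wordW n)) := by
    intro l hl
    induction l with
    | nil => simp
    | cons i l ih =>
      rw [List.flatMap_cons, ← List.singleton_append]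
      refine List.Sublist.append ?_ (ih fun j hj => hl j (List.mem_cons_of_mem _ hj))
      rw [List.singleton_sublist, wordW, List.mem_reverse, List.mem_range'_1]
      have := hl i List.mem_cons_self
      omega
  refine h2 _ fun i hi => ?_
  rw [List.mem_range'_1] at hi
  omega

/-- In an increasing word each particle vacates its place just before the next one needs it, so a
whole train of particles moves down by one. -/
theorem path_range'_min {a : Fin p → ℕ} (ha : StrictMono a) (han : ∀ s, a s ≤ n) (T : ℕ) :
    ParticlePath (List.range' 2 (n - 1)) (fun s => min (a s) (s + 1 + (T + 1)))
      (fun s => min (a s) (s + 1 + T)) := by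
  -- The letter T + 2 + m serves particle m, which moves only if it still stands at T + 2 + m.
  have key : ∀ m, ParticlePath (List.range' (2 + T) m) (fun s => min (a s) (s + 1 + (T + 1)))
      (fun s => if (s : ℕ) < m then min (a s) (s + 1 + T) else min (a s) (s + 1 + (T + 1))) := by
    intro m
    induction m with
    | zero => simpa using ParticlePath.nil _
    | succ m ih =>
      rw [List.range'_1_concat]
      refine ih.append ?_
      by_cases hm : ∃ h : m < p, m + 2 + T ≤ a ⟨m, h⟩
      · obtain ⟨hm, hle⟩ := hm
        rw [show 2 + T + m = T + m + 2 by omega]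
        refine ParticlePath.move _ ⟨m, hm⟩ ?_ (fun s => ?_) ?_
        · simp only [lt_irrefl, if_false]; omega
        · rcases lt_trichotomy (s : ℕ) m with h | h | h
          · rw [if_pos h]; omega
          · have : s = ⟨m, hm⟩ := Fin.ext h
            subst this
            simp only [lt_irrefl, if_false]; omega
          · have h' : (⟨m, hm⟩ : Fin p) < s := h
            have := ha h'
            rw [if_neg (by omega)]; omega
        · convert ParticlePath.nil _ using 1
          ext s
          by_cases hs : s = ⟨m, hm⟩
          · subst hs
            simp
            omega
          · have : (s : ℕ) ≠ m := fun e => hs (Fin.ext e)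
            rw [Function.update_of_ne hs]
            split_ifs <;> omega
      · convert ParticlePath.refl _ _ using 1
        ext s
        by_cases hs : (s : ℕ) = m
        · subst hs
          have : ¬ ((s : ℕ) + 2 + T ≤ a s) := fun h => hm ⟨s.isLt, h⟩
          split_ifs <;> omega
        · split_ifs <;> omega
  have hsub : (List.range' (2 + T) (n - 1 - T)).Sublist (List.range' 2 (n - 1)) := by
    by_cases hT : T ≤ n - 1
    · have : List.range' 2 (n - 1) = List.range' 2 T ++ List.range' (2 + T) (n - 1 - T) := by
        rw [List.range'_append_1]
        congr 1
        omega
      rw [this]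
      exact List.sublist_append_right _ _
    · rw [show n - 1 - T = 0 by omega]
      exact List.nil_sublist _
  -- For s ≥ n - 1 - T both bounds are at least n, so these particles need not move.
  convert (key (n - 1 - T)).mono hsub using 1
  ext s
  have := han s
  split_ifs <;> omega

/-- The first copy uses its blocks to leave an excess of at most s - 2 over the final positions;
each of the other copies removes one unit. -/
theorem path_wordZ2 {s k : ℕ} (hs : 2 ≤ s) (hsn : s ≤ n) (hk : s - 1 ≤ k) {a : Fin p → ℕ}
    (ha : StrictMono a) (ha1 : ∀ t, 1 ≤ a t) (han : ∀ t, a t ≤ n) :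
    ParticlePath (List.replicate k (wordZ2 n s)).flatten a fun t => (t : ℕ) + 1 := by
  obtain ⟨k, rfl⟩ : ∃ k', k = k' + 1 := ⟨k - 1, by omega⟩
  rw [List.replicate_succ, List.flatten_cons]
  have h1 : ParticlePath (wordZ2 n s) a fun t => min (a t) (t + 1 + (s - 2)) := by
    have : ParticlePath (wordZ2 n s) _ _ :=
      (path_flatMap_wordW_partialSort (s - 2) ha han ha1 (n + 1 - s) 0 s (by omega)).mono
        (List.sublist_append_right (List.range' 2 (s - 2)) _)
    rw [partialSort_zero] at this
    convert this using 1
    ext t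
    have := han t
    simp only [partialSort]
    split_ifs <;> omega
  refine h1.append ?_
  have h2 := ParticlePath.replicate_flatten (v := wordZ2 n s)
    (fun t i => min (a i) (i + 1 + (s - 2 - t))) k fun t => by
      by_cases ht : t < s - 2
      · have := (path_range'_min ha han (s - 2 - (t + 1))).mono (range'_sublist_wordZ2 hs hsn)
        rwa [show s - 2 - (t + 1) + 1 = s - 2 - t by omega] at this
      · rw [show s - 2 - (t + 1) = s - 2 - t by omega]
        exact ParticlePath.refl _ _
  simp only [Nat.sub_zero] at h2
  convert h2 using 1
  ext t
  have := add_one_le_of_strictMono ha ha1 t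
  omega

/-- Common letters of the matrices in the class `Z_i(s)`. -/
def wordZ (n : ℕ) : ZIndex → ℕ → List ℕ
  | .one, s => wordZ1 n s
  | .two, s => wordZ2 n s

theorem covers_of_mem_classZ {i : ZIndex} {s : ℕ} (hs : s ∈ Set.Icc 2 n)
    {M : Matrix (Fin n) (Fin n) ℝ} (hM : M ∈ classZ n i s) : Covers (wordZ n i s) M := by
  obtain ⟨hs2, hsn⟩ := hs
  cases i with
  | one =>
    obtain ⟨l, hl, rfl⟩ := hM
    refine Covers.flatMap _ _ _ fun i hi => Covers.blockW fun j hij hj => ?_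
    rw [List.mem_range'_1] at hi
    exact hl i j hi.1 (by omega) hij hj
  | two =>
    obtain ⟨q, P, l, hq, hP, hl, rfl⟩ := hM
    refine Covers.mul ?_ (Covers.flatMap _ _ _ fun i hi => Covers.blockW fun j hij hj => ?_)
    · by_cases h2 : s = 2
      · subst h2
        rw [if_pos rfl] at hP
        subst hP
        simpa using Covers.one
      · rw [if_neg h2] at hP
        obtain ⟨w, hw, hw', -, rfl⟩ := hP
        -- Only the last letter s - 1 of P is sure to have a positive multiplier; the other letters
        -- of P contribute the empty word.
        have h3 : List.range' 2 (s - 2) = List.range' 2 (s - 3) ++ ([] ++ [s - 1]) := by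
          rw [show s - 2 = s - 3 + 1 by omega, List.range'_1_concat]
          congr 2
          omega
        rw [h3]
        refine Covers.mul (Covers.of_forall_pos _ _ fun i hi => ?_) ?_
        · rw [List.mem_range'_1] at hi
          exact hq i hi.1 (by omega)
        · have h4 : n + 1 - (s - 1) = n + 1 - s + 1 := by omega
          rw [blockW, h4, List.range'_succ, List.reverse_cons, List.map_append, List.prod_append]
          refine Covers.mul (Covers.of_forall_nonneg _ _ fun i hi => ?_)
            (Covers.of_forall_pos [s - 1] w fun i hi => ?_)
          · rw [List.mem_reverse, List.mem_range'_1] at hi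
            exact hw' i (by omega) (by omega)
          · rw [List.mem_singleton] at hi
            rwa [hi]
    · rw [List.mem_range'_1] at hi
      exact hl i j hi.1 hij hj

theorem path_wordZ {i : ZIndex} {s k : ℕ} (hs : s ∈ Set.Icc 2 n) (hk : mu n i s ≤ k)
    {a : Fin p → ℕ} (ha : StrictMono a) (ha1 : ∀ t, 1 ≤ a t) (han : ∀ t, a t ≤ n) :
    ParticlePath (List.replicate k (wordZ n i s)).flatten a fun t => (t : ℕ) + 1 := by
  obtain ⟨hs2, hsn⟩ := hs
  cases i with
  | one =>
    refine path_wordZ1 ?_ ha ha1 han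
    have hpos : (0 : ℝ) < (s : ℝ) - 1 := by
      have : (2 : ℝ) ≤ s := by exact_mod_cast hs2
      linarith
    have h := Nat.ceil_le.1 hk
    rw [div_le_iff₀ hpos] at h
    have : (n : ℝ) ≤ ((1 + k * (s - 1) : ℕ) : ℝ) := by
      push_cast [Nat.cast_sub (show 1 ≤ s by omega)]
      linarith
    exact_mod_cast this
  | two => exact path_wordZ2 hs2 hsn hk ha ha1 han

end Words

/-- Products of sufficiently many factors are totally positive. -/
theorem isTP_list_prod_of_mu_le {n : ℕ} {i j : ZIndex} {si sj : ℕ} (hsi : si ∈ Set.Icc 2 n)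
    (hsj : sj ∈ Set.Icc 2 n) (l : List (Matrix (Fin n) (Fin n) ℝ))
    (hl : ∀ X ∈ l, HasFactors (classZ n i si) (classZ n j sj) X)
    (hi : mu n i si ≤ l.length) (hj : mu n j sj ≤ l.length) : IsTP l.prod := by
  obtain ⟨L, U, d, hL, hU, hd, h⟩ := HasFactors.list_prod (v := wordZ n i si)
    (w := wordZ n j sj) l fun X hX => by
      obtain ⟨L, U, d, hL, hU, hd, h⟩ := hl X hX
      exact ⟨L, U, d, covers_of_mem_classZ hsi hL, covers_of_mem_classZ hsj hU, hd, h⟩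
  rw [h]
  exact isTP_of_covers hL hU hd (fun p a ha ha1 han => path_wordZ hsi hi ha ha1 han)
    fun p a ha ha1 han => path_wordZ hsj hj ha ha1 han

/-! ### Necessity for `Z_2`: the support of the last row -/

section RowSupport

variable {n : ℕ}

/-- The first `c - 1` entries of `v` are zero. -/
def LowZero (c : ℕ) (v : Fin n → ℝ) : Prop := ∀ b : Fin n, (b : ℕ) + 1 < c → v b = 0

theorem LowZero.anti {c c' : ℕ} {v : Fin n → ℝ} (h : LowZero c v) (hc : c' ≤ c) :
    LowZero c' v := fun b hb => h b (by omega)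

/-- L_j adds a multiple of entry j to entry j - 1, so only the letter c can push a nonzero entry
below position c. -/
theorem LowZero.vecMul_elemL {c j : ℕ} {q : ℝ} {v : Fin n → ℝ} (h : LowZero c v)
    (hj : j ≠ c ∨ q = 0) : LowZero c (Matrix.vecMul v (elemL n j q)) := by
  rcases hj with hj | rfl
  · intro b hb
    rw [elemL, Matrix.vecMul_add, Matrix.vecMul_one, Pi.add_apply, h b hb, zero_add]
    rw [Matrix.vecMul, dotProduct]
    refine Finset.sum_eq_zero fun a _ => ?_
    rw [Matrix.of_apply]
    split_ifs with hab
    · rw [h a (by omega), zero_mul]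
    · exact mul_zero _
  · rwa [elemL_zero, Matrix.vecMul_one]

theorem LowZero.vecMul_elemL_pred {c : ℕ} (j : ℕ) (q : ℝ) {v : Fin n → ℝ} (h : LowZero c v) :
    LowZero (c - 1) (Matrix.vecMul v (elemL n j q)) := by
  by_cases hj : j ≠ c
  · exact (h.vecMul_elemL (Or.inl hj)).anti (Nat.sub_le c 1)
  · rcases Nat.eq_zero_or_pos c with rfl | hc
    · intro b hb
      omega
    · exact (h.anti (Nat.sub_le c 1)).vecMul_elemL (Or.inl (by omega))

theorem LowZero.vecMul_upper {c : ℕ} {v : Fin n → ℝ} (h : LowZero c v)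
    {B : Matrix (Fin n) (Fin n) ℝ} (hB : B.BlockTriangular id) :
    LowZero c (Matrix.vecMul v B) := by
  intro b hb
  rw [Matrix.vecMul, dotProduct]
  refine Finset.sum_eq_zero fun a _ => ?_
  by_cases ha : (a : ℕ) + 1 < c
  · rw [h a ha, zero_mul]
  · have hba : b < a := by rw [Fin.lt_def]; omega
    rw [hB hba, mul_zero]

theorem LowZero.vecMul_list_prod {c : ℕ} (l : List (Matrix (Fin n) (Fin n) ℝ))
    (hl : ∀ X ∈ l, ∀ v : Fin n → ℝ, LowZero c v → LowZero c (Matrix.vecMul v X))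
    {v : Fin n → ℝ} (h : LowZero c v) : LowZero c (Matrix.vecMul v l.prod) := by
  induction l generalizing v with
  | nil => simpa using h
  | cons X l ih =>
    rw [List.prod_cons, ← Matrix.vecMul_vecMul]
    exact ih (fun Y hY => hl Y (List.mem_cons_of_mem _ hY)) (hl X List.mem_cons_self v h)

theorem LowZero.vecMul_elemL_list {c : ℕ} (l : List ℕ) (w : ℕ → ℝ)
    (hl : ∀ j ∈ l, j ≠ c ∨ w j = 0) {v : Fin n → ℝ} (h : LowZero c v) :
    LowZero c (Matrix.vecMul v (l.map fun j => elemL n j (w j)).prod) := by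
  refine LowZero.vecMul_list_prod _ (fun X hX v hv => ?_) h
  obtain ⟨j, hj, rfl⟩ := List.mem_map.1 hX
  exact hv.vecMul_elemL (hl j hj)

/-- Reading an increasing word shifts the support by at most one. -/
theorem LowZero.vecMul_ascending {c : ℕ} (l : List ℕ) (hl : l.Pairwise (· < ·)) (w : ℕ → ℝ)
    {v : Fin n → ℝ} (h : LowZero c v) :
    LowZero (c - 1) (Matrix.vecMul v (l.map fun j => elemL n j (w j)).prod) := by
  induction l generalizing v with
  | nil => simpa using h.anti (Nat.sub_le c 1)
  | cons j l ih =>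
    rw [List.pairwise_cons] at hl
    rw [List.map_cons, List.prod_cons, ← Matrix.vecMul_vecMul]
    by_cases hj : j = c
    · subst hj
      refine LowZero.vecMul_elemL_list l w (fun i hi => Or.inl ?_) (h.vecMul_elemL_pred j (w j))
      have := hl.1 i hi
      omega
    · exact ih hl.2 (h.vecMul_elemL (Or.inl hj))

theorem LowZero.vecMul_blockW {c i : ℕ} (w : ℕ → ℝ) {v : Fin n → ℝ} (h : LowZero c v)
    (hi : ∀ j, i ≤ j → j ≤ n → j ≠ c ∨ w j = 0) : LowZero c (Matrix.vecMul v (blockW n i w)) := by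
  refine LowZero.vecMul_elemL_list _ w (fun j hj => ?_) h
  rw [List.mem_reverse, List.mem_range'_1] at hj
  exact hi j hj.1 (by omega)

theorem LowZero.vecMul_blocks {c s m : ℕ} (hc : c < s) (l : ℕ → ℕ → ℝ) {v : Fin n → ℝ}
    (h : LowZero c v) :
    LowZero c (Matrix.vecMul v ((List.range' s m).map fun i => blockW n i (l i)).prod) := by
  refine LowZero.vecMul_list_prod _ (fun X hX v hv => ?_) h
  obtain ⟨i, hi, rfl⟩ := List.mem_map.1 hX
  rw [List.mem_range'_1] at hi
  exact hv.vecMul_blockW _ fun j hj _ => Or.inl (by omega)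

/-- The letters before P are all smaller than n. If g > s - 1 is an index with zero multiplier, P
cannot carry the support below g, and the blocks W_s, …, W_n lack the letter s - 1. -/
theorem LowZero.vecMul_classZ2_first {s : ℕ} (hs : 3 ≤ s) (hsn : s ≤ n)
    {L : Matrix (Fin n) (Fin n) ℝ} (hL : L ∈ classZ2 n s) {v : Fin n → ℝ} (h : LowZero n v) :
    LowZero (s - 1) (Matrix.vecMul v L) := by
  obtain ⟨q, P, l, -, hP, -, rfl⟩ := hL
  rw [if_neg (by omega)] at hP
  obtain ⟨w, -, -, ⟨g, hg, hgn, hwg⟩, rfl⟩ := hP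
  rw [← Matrix.vecMul_vecMul, ← Matrix.vecMul_vecMul]
  refine LowZero.vecMul_blocks (by omega) l (LowZero.anti (c := g) ?_ (by omega))
  refine LowZero.vecMul_blockW w (LowZero.anti (c := n) ?_ hgn) fun j _ _ => ?_
  · refine LowZero.vecMul_elemL_list _ q (fun i hi => Or.inl ?_) h
    rw [List.mem_range'_1] at hi
    omega
  · by_cases hj : j = g
    · exact Or.inr (hj ▸ hwg)
    · exact Or.inl hj

theorem LowZero.vecMul_classZ2_next {s c : ℕ} (hs : 3 ≤ s) (hc : c < s)
    {L : Matrix (Fin n) (Fin n) ℝ} (hL : L ∈ classZ2 n s) {v : Fin n → ℝ} (h : LowZero c v) :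
    LowZero (c - 1) (Matrix.vecMul v L) := by
  obtain ⟨q, P, l, -, hP, -, rfl⟩ := hL
  rw [if_neg (by omega)] at hP
  obtain ⟨w, -, -, -, rfl⟩ := hP
  rw [← Matrix.vecMul_vecMul, ← Matrix.vecMul_vecMul]
  refine LowZero.vecMul_blocks (by omega) l ?_
  -- If c = s - 1, only P contains the letter c, and it does not contain c - 1; if c < s - 1, only
  -- the increasing part can act.
  by_cases hcs : c = s - 1
  · have h1 : LowZero c (Matrix.vecMul v
        ((List.range' 2 (s - 3)).map fun i => elemL n i (q i)).prod) := by
      refine LowZero.vecMul_elemL_list _ q (fun i hi => Or.inl ?_) h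
      rw [List.mem_range'_1] at hi
      omega
    exact (h1.anti (Nat.sub_le c 1)).vecMul_blockW w fun j hj _ => Or.inl (by omega)
  · exact (h.vecMul_ascending _ (List.pairwise_lt_range' 1) q).vecMul_blockW w
      fun j hj _ => Or.inl (by omega)

theorem le_length_of_isTP_of_classZ2 {s : ℕ} (hn : 2 ≤ n) (hs : s ∈ Set.Icc 2 n)
    (l : List (Matrix (Fin n) (Fin n) ℝ))
    (hl : ∀ X ∈ l, ∃ L B, L ∈ classZ2 n s ∧ B.BlockTriangular id ∧ X = L * B)
    (h : IsTP l.prod) : s - 1 ≤ l.length := by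
  obtain ⟨hs2, hsn⟩ := hs
  have hpos : 0 < l.prod ⟨n - 1, by omega⟩ ⟨0, by omega⟩ := by
    have := h 1 (fun _ => ⟨n - 1, by omega⟩) (fun _ => ⟨0, by omega⟩)
      (Subsingleton.strictMono _) (Subsingleton.strictMono _)
    simpa using this
  by_contra hlt
  set e : Fin n → ℝ := Pi.single ⟨n - 1, by omega⟩ 1 with he
  have he0 : LowZero n e := by
    intro b hb
    rw [he, Pi.single_eq_of_ne]
    intro hb'
    rw [Fin.ext_iff] at hb'
    simp only at hb'
    omega
  have hrow : LowZero (s - l.length) (Matrix.vecMul e l.prod) := by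
    cases l with
    | nil => simpa using he0.anti hsn
    | cons X l =>
      rw [List.length_cons] at hlt
      have hs3 : 3 ≤ s := by omega
      have hnext : ∀ (l : List (Matrix (Fin n) (Fin n) ℝ)) (c : ℕ) (v : Fin n → ℝ),
          (∀ X ∈ l, ∃ L B, L ∈ classZ2 n s ∧ B.BlockTriangular id ∧ X = L * B) → c < s →
          LowZero c v → LowZero (c - l.length) (Matrix.vecMul v l.prod) := by
        intro l
        induction l with
        | nil => intro c v _ _ hv; simpa using hv
        | cons X l ih =>
          intro c v hX hc hv
          obtain ⟨L, B, hL, hB, rfl⟩ := hX X List.mem_cons_self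
          rw [List.prod_cons, ← Matrix.vecMul_vecMul, ← Matrix.vecMul_vecMul, List.length_cons,
            show c - (l.length + 1) = c - 1 - l.length by omega]
          exact ih (c - 1) _ (fun Y hY => hX Y (List.mem_cons_of_mem _ hY)) (by omega)
            ((hv.vecMul_classZ2_next hs3 hc hL).vecMul_upper hB)
      obtain ⟨L, B, hL, hB, rfl⟩ := hl X List.mem_cons_self
      rw [List.prod_cons, ← Matrix.vecMul_vecMul, ← Matrix.vecMul_vecMul, List.length_cons,
        show s - (l.length + 1) = s - 1 - l.length by omega]
      exact hnext l _ _ (fun Y hY => hl Y (List.mem_cons_of_mem _ hY)) (by omega)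
        ((he0.vecMul_classZ2_first hs3 hsn hL).vecMul_upper hB)
  -- Fewer than s - 1 factors leave s - `l.length` > 1, so the first entry of the last row is zero.
  have := hrow ⟨0, by omega⟩ (by simp only; omega)
  rw [he, Matrix.single_one_vecMul] at this
  exact hpos.ne' this

end RowSupport

/-! ### Necessity for `Z_1`: the support of the first column of the inverse -/

section ColumnSupport

variable {n : ℕ}

/-- Only the first `h` entries of `w` may be nonzero. -/
def HighZero (h : ℕ) (w : Fin n → ℝ) : Prop := ∀ a : Fin n, h < (a : ℕ) + 1 → w a = 0

theorem HighZero.mono {h h' : ℕ} {w : Fin n → ℝ} (hw : HighZero h w) (hh : h ≤ h') :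
    HighZero h' w := fun a ha => hw a (by omega)

theorem inv_elemL (j : ℕ) (q : ℝ) : (elemL n j q)⁻¹ = elemL n j (-q) :=
  Matrix.inv_eq_right_inv (elemL_mul_elemL_neg n j q)

theorem HighZero.inv_elemL_mulVec {h j : ℕ} (q : ℝ) {w : Fin n → ℝ} (hw : HighZero h w)
    (hj : j ≠ h + 1) : HighZero h (Matrix.mulVec (elemL n j q)⁻¹ w) := by
  intro a ha
  rw [inv_elemL, elemL, Matrix.add_mulVec, Matrix.one_mulVec, Pi.add_apply, hw a ha, zero_add]
  rw [Matrix.mulVec, dotProduct]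
  refine Finset.sum_eq_zero fun b _ => ?_
  rw [Matrix.of_apply]
  split_ifs with hab
  · rw [hw b (by omega), mul_zero]
  · exact zero_mul _

theorem HighZero.inv_elemL_mulVec_succ {h : ℕ} (j : ℕ) (q : ℝ) {w : Fin n → ℝ}
    (hw : HighZero h w) : HighZero (h + 1) (Matrix.mulVec (elemL n j q)⁻¹ w) := by
  by_cases hj : j = h + 1
  · exact (hw.mono (Nat.le_succ h)).inv_elemL_mulVec q (by omega)
  · exact (hw.inv_elemL_mulVec q hj).mono (Nat.le_succ h)

theorem HighZero.upper_mulVec {h : ℕ} {w : Fin n → ℝ} (hw : HighZero h w)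
    {B : Matrix (Fin n) (Fin n) ℝ} (hB : B.BlockTriangular id) :
    HighZero h (Matrix.mulVec B w) := by
  intro a ha
  rw [Matrix.mulVec, dotProduct]
  refine Finset.sum_eq_zero fun b _ => ?_
  by_cases hb : h < (b : ℕ) + 1
  · rw [hw b hb, mul_zero]
  · have hba : b < a := by rw [Fin.lt_def]; omega
    rw [hB hba, zero_mul]

/-- If the inverse of each factor enlarges the support by at most `g`, so does the inverse of the
product by at most `g` times the number of factors. -/
theorem HighZero.inv_list_prod_mulVec {g : ℕ} (l : List (Matrix (Fin n) (Fin n) ℝ))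
    (hl : ∀ X ∈ l, ∀ (h : ℕ) (w : Fin n → ℝ), HighZero h w →
      HighZero (h + g) (Matrix.mulVec X⁻¹ w))
    {h : ℕ} {w : Fin n → ℝ} (hw : HighZero h w) :
    HighZero (h + l.length * g) (Matrix.mulVec l.prod⁻¹ w) := by
  induction l generalizing h w with
  | nil => simpa using hw
  | cons X l ih =>
    rw [List.prod_cons, Matrix.mul_inv_rev, ← Matrix.mulVec_mulVec, List.length_cons,
      show h + (l.length + 1) * g = h + g + l.length * g by ring]
    exact ih (fun Y hY => hl Y (List.mem_cons_of_mem _ hY)) (hl X List.mem_cons_self h w hw)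

theorem HighZero.inv_elemL_list_mulVec {h : ℕ} (l : List ℕ) (q : ℕ → ℝ)
    (hl : ∀ j ∈ l, j ≠ h + 1) {w : Fin n → ℝ} (hw : HighZero h w) :
    HighZero h (Matrix.mulVec (l.map fun j => elemL n j (q j)).prod⁻¹ w) := by
  induction l generalizing w with
  | nil => simpa using hw
  | cons j l ih =>
    rw [List.map_cons, List.prod_cons, Matrix.mul_inv_rev, ← Matrix.mulVec_mulVec]
    exact ih (fun i hi => hl i (List.mem_cons_of_mem _ hi))
      (hw.inv_elemL_mulVec _ (hl j List.mem_cons_self))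

/-- The inverse of a product over a decreasing word enlarges the support by at most one. -/
theorem HighZero.inv_descending_mulVec (l : List ℕ) (hl : l.Pairwise (· > ·)) (q : ℕ → ℝ) {h : ℕ}
    {w : Fin n → ℝ} (hw : HighZero h w) :
    HighZero (h + 1) (Matrix.mulVec (l.map fun j => elemL n j (q j)).prod⁻¹ w) := by
  induction l generalizing w with
  | nil => simpa using hw.mono (Nat.le_succ h)
  | cons j l ih =>
    rw [List.pairwise_cons] at hl
    rw [List.map_cons, List.prod_cons, Matrix.mul_inv_rev, ← Matrix.mulVec_mulVec]
    by_cases hj : j = h + 1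
    · refine HighZero.inv_elemL_list_mulVec l q (fun i hi => ?_) (hw.inv_elemL_mulVec_succ j (q j))
      have := hl.1 i hi
      omega
    · exact ih hl.2 (hw.inv_elemL_mulVec _ hj)

/-- In the inverse of a block the largest index acts first, so each of the s - 1 blocks extends the
support by at most one. -/
theorem HighZero.inv_classZ1_mulVec {s : ℕ} {L : Matrix (Fin n) (Fin n) ℝ} (hL : L ∈ classZ1 n s)
    {h : ℕ} {w : Fin n → ℝ} (hw : HighZero h w) :
    HighZero (h + (s - 1)) (Matrix.mulVec L⁻¹ w) := by
  obtain ⟨l, -, rfl⟩ := hL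
  have := HighZero.inv_list_prod_mulVec (g := 1)
    ((List.range' 2 (s - 1)).map fun i => blockW n i (l i)) (fun X hX h w hw => by
      obtain ⟨i, -, rfl⟩ := List.mem_map.1 hX
      exact hw.inv_descending_mulVec _
        (List.pairwise_reverse.2 (List.pairwise_lt_range' 1)) _) hw
  simpa using this

theorem le_of_isTP_of_classZ1 {s : ℕ} (l : List (Matrix (Fin n) (Fin n) ℝ))
    (hl : ∀ X ∈ l, ∃ L B, L ∈ classZ1 n s ∧ B.BlockTriangular id ∧ IsUnit B.det ∧ X = L * B)
    (h : IsTP l.prod) : n ≤ 1 + l.length * (s - 1) := by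
  by_contra hlt
  obtain ⟨N, rfl⟩ : ∃ N, n = N + 1 := ⟨n - 1, by omega⟩
  have hminor : 0 < (l.prod.submatrix Fin.succ Fin.castSucc).det :=
    h N _ _ Fin.strictMono_succ Fin.strictMono_castSucc
  have hdet : 0 < l.prod.det := by
    simpa using h (N + 1) id id strictMono_id strictMono_id
  have he0 : HighZero 1 (Pi.single 0 1 : Fin (N + 1) → ℝ) := by
    intro a ha
    rw [Pi.single_eq_of_ne]
    rintro rfl
    simp at ha
  have hcol := HighZero.inv_list_prod_mulVec (g := s - 1) l (fun X hX h w hw => by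
    obtain ⟨L, B, hL, hB, hBdet, rfl⟩ := hl X hX
    rw [Matrix.mul_inv_rev, ← Matrix.mulVec_mulVec]
    have := Matrix.invertibleOfIsUnitDet B hBdet
    exact (hw.inv_classZ1_mulVec hL).upper_mulVec
      (Matrix.blockTriangular_inv_of_blockTriangular hB)) he0
  have hzero := hcol (Fin.last N) (by rw [Fin.val_last]; omega)
  -- By Cramer's rule the (n,1) entry of the inverse is, up to sign, `hminor`'s determinant divided
  -- by that of the product; neither is zero.
  rw [Matrix.mulVec_single_one, Matrix.col_apply, Matrix.inv_def, Matrix.smul_apply,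
    Matrix.adjugate_fin_succ_eq_det_submatrix, Fin.succAbove_zero, Fin.succAbove_last,
    Ring.inverse_eq_inv', smul_eq_mul] at hzero
  have h1 : (-1 : ℝ) ^ (((0 : Fin (N + 1)) : ℕ) + (Fin.last N : ℕ)) ≠ 0 :=
    pow_ne_zero _ (by norm_num)
  exact mul_ne_zero (inv_ne_zero hdet.ne') (mul_ne_zero h1 hminor.ne') hzero

end ColumnSupport

/-! ### The two bounds combined -/

/-- Total positivity of a product forces the number of factors to be at least `μ_i(s_i)`. -/
theorem mu_le_length_of_isTP {n : ℕ} (hn : 2 ≤ n) {i j : ZIndex} {si sj : ℕ}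
    (hsi : si ∈ Set.Icc 2 n) (hsj : sj ∈ Set.Icc 2 n) (l : List (Matrix (Fin n) (Fin n) ℝ))
    (hl : ∀ X ∈ l, HasFactors (classZ n i si) (classZ n j sj) X) (h : IsTP l.prod) :
    mu n i si ≤ l.length := by
  have hl' : ∀ X ∈ l, ∃ L B, L ∈ classZ n i si ∧ B.BlockTriangular id ∧ IsUnit B.det ∧
      X = L * B := by
    intro X hX
    obtain ⟨L, U, d, hL, hU, hd, rfl⟩ := hl X hX
    have hU' := covers_of_mem_classZ hsj hU
    refine ⟨L, _, hL, (Matrix.blockTriangular_diagonal d).mul hU'.blockTriangular_transpose,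
      ?_, rfl⟩
    rw [Matrix.det_mul, Matrix.det_transpose, hU'.det, Matrix.det_diagonal, mul_one]
    exact (Finset.prod_pos fun x _ => hd x).ne'.isUnit
  cases i with
  | one =>
    have := le_of_isTP_of_classZ1 l hl' h
    have hs2 := hsi.1
    have hpos : (0 : ℝ) < (si : ℝ) - 1 := by
      have : (2 : ℝ) ≤ si := by exact_mod_cast hs2
      linarith
    refine Nat.ceil_le.2 ((div_le_iff₀ hpos).2 ?_)
    have h' : (n : ℝ) ≤ ((1 + l.length * (si - 1) : ℕ) : ℝ) := by exact_mod_cast this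
    push_cast [Nat.cast_sub (show 1 ≤ si by omega)] at h'
    linarith
  | two =>
    exact le_length_of_isTP_of_classZ2 hn hsi l (fun X hX => by
      obtain ⟨L, B, hL, hB, -, rfl⟩ := hl' X hX
      exact ⟨L, B, hL, hB, rfl⟩) h

theorem corollary2 {n m : ℕ} (hn : 2 ≤ n)
    (A : Fin m → Matrix (Fin n) (Fin n) ℝ)
    (hA : ∀ x, IsOscillatory (A x))
    (l u : Fin m → ℕ → ℕ → ℝ) (d : Fin m → Fin n → ℝ)
    (hSEB : ∀ x, IsSEBFactorization (A x) (l x) (d x) (u x))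
    (i j : ZIndex) (si sj : ℕ)
    (hsi : si ∈ Set.Icc 2 n) (hsj : sj ∈ Set.Icc 2 n)
    (hL : ∀ x, lowerFactor n (l x) ∈ classZ n i si)
    (hU : ∀ x, (upperFactor n (u x)).transpose ∈ classZ n j sj)
    (k : ℕ) (f : Fin k → Fin m) :
    IsTP (List.ofFn fun t => A (f t)).prod ↔ max (mu n i si) (mu n j sj) ≤ k := by
  set X := List.ofFn fun t => A (f t) with hX
  have hlen : X.length = k := by simp [hX]
  have hfac : ∀ Y ∈ X, HasFactors (classZ n i si) (classZ n j sj) Y := by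
    intro Y hY
    obtain ⟨t, rfl⟩ := List.mem_ofFn.1 hY
    exact ⟨_, _, d (f t), hL (f t), hU (f t), (hSEB (f t)).diag_pos, by
      rw [(hSEB (f t)).eq_mul, Matrix.transpose_transpose, Matrix.mul_assoc]⟩
  rw [max_le_iff, ← hlen]
  refine ⟨fun h => ⟨mu_le_length_of_isTP hn hsi hsj X hfac h, ?_⟩,
    fun h => isTP_list_prod_of_mu_le hsi hsj X hfac h.1 h.2⟩
  -- Transposition turns the factors L D U into Uᵀ D Lᵀ in reverse order, so the bound for the lower
  -- factors applies to the upper ones.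
  have h' := h.transpose
  rw [Matrix.transpose_list_prod] at h'
  have := mu_le_length_of_isTP hn hsj hsi _ (fun Y hY => by
    rw [List.mem_reverse, List.mem_map] at hY
    obtain ⟨Z, hZ, rfl⟩ := hY
    exact (hfac Z hZ).transpose) h'
  simpa using this
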